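/- Let $s,t\ge 0$ be integers with $s+t>1$, let $m\ge 1$, $k=2^{s+t}$, and let $\mathcal O=\mathcal{C}l(s,t)$ be the real Clifford algebra generated by pairwise anticommuting elements $J_1,\dots,J_s$, $I_1,\dots,I_t$ with $J_j^2=1$, $I_i^2=-1$. Identify $\mathbb V:=\mathbb R^{km}$ with $\mathcal O^m$ by any linear isomorphism, regard the generators as endomorphisms of $\mathbb V$ (multiplication in each component), and put $$G=GL(m,\mathcal O)=\{B\in GL(km,\mathbb R)\mid BI_i=I_iB,\ BJ_j=J_jB \text{ for all } i,j\},$$ with Lie algebra $\mathfrak g\subset\mathfrak{gl}(\mathbb V)$. Let $M$ be a smooth manifold of dimension $km$ with an almost Clifford structure, i.e. a $G$-structure $P\to M$: a smooth reduction to $G$ of the bundle of linear frames $u:\mathbb V\to T_xM$. For $r\ge 0$ let $\mathfrak g^{(r)}$ be the $r$-th prolongation of $\mathfrak g$: the space of symmetric $(r+1)$-linear maps $\mathbb V^{r+1}\to\mathbb V$ which, when all arguments but one are fixed, give an element of $\mathfrak g$ (so $\mathfrak g^{(0)}=\mathfrak g$). A $G$-structure is of type $r\ge1$ if $\mathfrak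 g^{(r)}=0$ and $\mathfrak g^{(r-1)}\neq0$. Let $\partial:\mathfrak g\otimes\mathbb V^*=\mathrm{Hom}(\mathbb V,\mathfrak g)\to\mathbb V\otimes\wedge^2\mathbb V^*$, $(\partial\varphi)(v,w)=\varphi(v)w-\varphi(w)v$. Then: 1. The $G$-structure $P$ is of type $1$, i.e. $\mathfrak g^{(1)}=0$ and $\mathfrak g\ne0$. 2. For every $G$-invariant subspace $\mathcal D$ with $\mathbb V\otimes\wedge^2\mathbb V^*=\partial(\mathfrak g\otimes\mathbb V^*)\oplus\mathcal D$ there exists a unique $\mathcal D$-connection on $P$, i.e. a unique smooth linear connection $\nabla$ on $TM$ that is induced by a connection on $P$ (its connection form in every local section of $P$ has values in $\mathfrak g$) and whose torsion $T$, read in any frame $u\in P$ at $x$ as $(v,w)\mapsto u^{-1}T_x(uv,uw)$, belongs to $\mathcal D$. -/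

import Mathlib

open scoped Manifold ContDiff

noncomputable section

/-! ### Linear Lie groups: Lie algebra, prolongations, type, Spencer operator -/

section LinearGroups

/-- The Lie algebra `𝔤 ⊆ 𝔤𝔩(V)` of a closed linear group `G ⊆ GL(V)`: the endomorphisms `A` whose
one-parameter group `exp (t A)` stays in `G`. For closed `G` this set is a linear subspace, so that
taking its span changes nothing. -/
def linearLieAlgebra {V : Type*} [NormedAddCommGroup V] [NormedSpace ℝ V]
    (G : Subgroup (V ≃L[ℝ] V)) : Submodule ℝ (V →L[ℝ] V) :=
  Submodule.span ℝ
    {A | ∀ t : ℝ, ∃ g ∈ G, ((g : V ≃L[ℝ] V) : V →L[ℝ] V) = NormedSpace.exp (t • A)}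

/-- The `k`-th prolongation `𝔤⁽ᵏ⁾` of `𝔤 ⊆ 𝔤𝔩(V)`: the symmetric `(k+1)`-linear maps
`t : V × ⋯ × V → V` such that, all arguments but one being fixed, the remaining linear map
`V → V` belongs to `𝔤`. Up to `𝔤𝔩(V) ≅ {1-linear maps}`, `𝔤⁽⁰⁾` is `𝔤`. -/
def prolongation {V : Type*} [NormedAddCommGroup V] [NormedSpace ℝ V]
    (𝔤 : Submodule ℝ (V →L[ℝ] V)) (k : ℕ) :
    Submodule ℝ (ContinuousMultilinearMap ℝ (fun _ : Fin (k + 1) => V) V) where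
  carrier := {t | (∀ (e : Equiv.Perm (Fin (k + 1))) (v : Fin (k + 1) → V), t (v ∘ e) = t v) ∧
    ∀ (v : Fin (k + 1) → V) (i : Fin (k + 1)), t.toContinuousLinearMap v i ∈ 𝔤}
  zero_mem' := ⟨fun _ _ => rfl, fun _ _ => 𝔤.zero_mem⟩
  add_mem' := fun {a b} ha hb =>
    ⟨fun e v => by simp [ha.1 e v, hb.1 e v], fun v i => 𝔤.add_mem (ha.2 v i) (hb.2 v i)⟩
  smul_mem' := fun c a ha =>
    ⟨fun e v => by simp [ha.1 e v], fun v i => 𝔤.smul_mem c (ha.2 v i)⟩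

/-- A linear Lie group is of type `k` (with `k ≥ 1`) if `𝔤⁽ᵏ⁾ = 0` and `𝔤⁽ᵏ⁻¹⁾ ≠ 0`. -/
def LinearGroupIsOfType {V : Type*} [NormedAddCommGroup V] [NormedSpace ℝ V]
    (G : Subgroup (V ≃L[ℝ] V)) (k : ℕ) : Prop :=
  1 ≤ k ∧ prolongation (linearLieAlgebra G) k = ⊥ ∧ prolongation (linearLieAlgebra G) (k - 1) ≠ ⊥

/-- The space `V ⊗ ⋀² V*` of alternating bilinear maps `V × V → V`. -/
def torsionSpace (V : Type*) [NormedAddCommGroup V] [NormedSpace ℝ V] :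
    Submodule ℝ (V →L[ℝ] V →L[ℝ] V) where
  carrier := {T | ∀ v, T v v = 0}
  zero_mem' := fun _ => rfl
  add_mem' := fun {a b} ha hb v => by simp [ha v, hb v]
  smul_mem' := fun c a ha v => by simp [ha v]

/-- The operator of alternation on bilinear maps, `(∂ φ)(v, w) = φ(v) w - φ(w) v`. -/
def spencer (V : Type*) [NormedAddCommGroup V] [NormedSpace ℝ V] :
    (V →L[ℝ] V →L[ℝ] V) →ₗ[ℝ] (V →L[ℝ] V →L[ℝ] V) where
  toFun φ := φ - φ.flip
  map_add' a b := by ext; simp; abel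
  map_smul' c a := by ext; simp [smul_sub]

/-- `Hom(V, 𝔤) = 𝔤 ⊗ V*`, as a space of bilinear maps. -/
def homInto {V : Type*} [NormedAddCommGroup V] [NormedSpace ℝ V]
    (𝔤 : Submodule ℝ (V →L[ℝ] V)) : Submodule ℝ (V →L[ℝ] V →L[ℝ] V) where
  carrier := {φ | ∀ v, φ v ∈ 𝔤}
  zero_mem' := fun _ => 𝔤.zero_mem
  add_mem' := fun ha hb v => 𝔤.add_mem (ha v) (hb v)
  smul_mem' := fun c _ ha v => 𝔤.smul_mem c (ha v)

/-- `D` is a `G`-invariant complement of `∂(𝔤 ⊗ V*)` in `V ⊗ ⋀² V*`. The action of `g` is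
`(g T)(v, w) = g (T (g⁻¹ v) (g⁻¹ w))`. -/
structure IsInvariantComplement {V : Type*} [NormedAddCommGroup V] [NormedSpace ℝ V]
    (G : Subgroup (V ≃L[ℝ] V)) (D : Submodule ℝ (V →L[ℝ] V →L[ℝ] V)) : Prop where
  inf_eq : (homInto (linearLieAlgebra G)).map (spencer V) ⊓ D = ⊥
  sup_eq : (homInto (linearLieAlgebra G)).map (spencer V) ⊔ D = torsionSpace V
  invariant : ∀ g ∈ G, ∀ T ∈ D, g.arrowCongr (g.arrowCongr g) T ∈ D

end LinearGroups

/-! ### `G`-structures and their connections -/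

section GStructures

/-- `s` is a smooth local section over `U` of the bundle of linear frames of `M`, a frame at `y`
being a linear isomorphism `V ≃ T_y M` (the values of `s` off `U` are irrelevant). -/
def IsSmoothLocalFrame {V : Type*} [NormedAddCommGroup V] [NormedSpace ℝ V]
    {M : Type*} [TopologicalSpace M] [ChartedSpace V M] [IsManifold 𝓘(ℝ, V) ∞ M]
    (s : ∀ y : M, V ≃L[ℝ] TangentSpace 𝓘(ℝ, V) y) (U : Set M) : Prop :=
  ∀ v : V, ContMDiffOn 𝓘(ℝ, V) 𝓘(ℝ, V).tangent ∞
    (fun y => (⟨y, s y v⟩ : TangentBundle 𝓘(ℝ, V) M)) U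

/-- A `G`-structure on `M`, for a closed subgroup `G ⊆ GL(V)`: a reduction to `G` of the bundle of
linear frames of `M`, i.e. a set `P` of frames which over each point is an orbit of the right
action `(u, g) ↦ u ∘ g` of `G`, and which has smooth local sections around every point. -/
structure GStructure {V : Type*} [NormedAddCommGroup V] [NormedSpace ℝ V]
    (G : Subgroup (V ≃L[ℝ] V))
    (M : Type*) [TopologicalSpace M] [ChartedSpace V M] [IsManifold 𝓘(ℝ, V) ∞ M] where
  /-- The adapted frames at a point. -/
  frames : ∀ x : M, Set (V ≃L[ℝ] TangentSpace 𝓘(ℝ, V) x)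
  mem_iff : ∀ (x : M), ∀ u ∈ frames x, ∀ u' : V ≃L[ℝ] TangentSpace 𝓘(ℝ, V) x,
    u' ∈ frames x ↔ ∃ g ∈ G, u' = g.trans u
  exists_section : ∀ x : M, ∃ (U : Set M) (s : ∀ y : M, V ≃L[ℝ] TangentSpace 𝓘(ℝ, V) y),
    IsOpen U ∧ x ∈ U ∧ IsSmoothLocalFrame s U ∧ ∀ y ∈ U, s y ∈ frames y

/-- A `G`-structure is of type `k` if its structure group `G` is. -/
def GStructure.IsOfType {V : Type*} [NormedAddCommGroup V] [NormedSpace ℝ V]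
    {G : Subgroup (V ≃L[ℝ] V)}
    {M : Type*} [TopologicalSpace M] [ChartedSpace V M] [IsManifold 𝓘(ℝ, V) ∞ M]
    (_P : GStructure G M) (k : ℕ) : Prop :=
  LinearGroupIsOfType G k

/-- The linear connection `∇` on `TM` is (induced by) a connection on the principal `G`-bundle `P`:
with respect to every local section `s` of `P` its connection form has values in `𝔤`, i.e.
`∇_X (s v) = s (A v)` with `A ∈ 𝔤` depending on the tangent vector `X` only. -/
def GStructure.IsConnection {V : Type*} [NormedAddCommGroup V] [NormedSpace ℝ V]
    {G : Subgroup (V ≃L[ℝ] V)}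
    {M : Type*} [TopologicalSpace M] [ChartedSpace V M] [IsManifold 𝓘(ℝ, V) ∞ M]
    (P : GStructure G M)
    (conn : CovariantDerivative 𝓘(ℝ, V) V (TangentSpace 𝓘(ℝ, V) : M → Type _)) : Prop :=
  ∀ (U : Set M) (s : ∀ y : M, V ≃L[ℝ] TangentSpace 𝓘(ℝ, V) y),
    IsOpen U → IsSmoothLocalFrame s U → (∀ y ∈ U, s y ∈ P.frames y) →
    ∀ x ∈ U, ∀ X : TangentSpace 𝓘(ℝ, V) x, ∃ A ∈ linearLieAlgebra G,
      ∀ v : V, conn (fun y => s y v) x X = s x (A v)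

/-- The torsion function of a linear connection at a frame `u` at `x`:
`(v, w) ↦ u⁻¹ (Tor_x (u v, u w))`. -/
def torsionFunction {V : Type*} [NormedAddCommGroup V] [NormedSpace ℝ V] [FiniteDimensional ℝ V]
    {M : Type*} [TopologicalSpace M] [ChartedSpace V M] [IsManifold 𝓘(ℝ, V) ∞ M]
    (conn : CovariantDerivative 𝓘(ℝ, V) V (TangentSpace 𝓘(ℝ, V) : M → Type _))
    {x : M} (u : V ≃L[ℝ] TangentSpace 𝓘(ℝ, V) x) : V →L[ℝ] V →L[ℝ] V :=
  haveI : CompleteSpace V := FiniteDimensional.complete ℝ V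
  u.symm.arrowCongr (u.symm.arrowCongr u.symm) (conn.torsion x)

/-- A `D`-connection on the `G`-structure `P`: a smooth connection on `P` whose torsion function
`P → V ⊗ ⋀² V*` has values in `D`. -/
structure GStructure.IsDConnection {V : Type*} [NormedAddCommGroup V] [NormedSpace ℝ V]
    [FiniteDimensional ℝ V] {G : Subgroup (V ≃L[ℝ] V)}
    {M : Type*} [TopologicalSpace M] [ChartedSpace V M] [IsManifold 𝓘(ℝ, V) ∞ M]
    (P : GStructure G M) (D : Submodule ℝ (V →L[ℝ] V →L[ℝ] V))
    (conn : CovariantDerivative 𝓘(ℝ, V) V (TangentSpace 𝓘(ℝ, V) : M → Type _)) : Prop where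
  smooth : CovariantDerivative.ContMDiffCovariantDerivative conn ∞
  isConnection : P.IsConnection conn
  torsion_mem : ∀ (x : M), ∀ u ∈ P.frames x, torsionFunction conn u ∈ D

/-- Two linear connections are the same if they agree on every vector field which is differentiable
at the point considered (a `CovariantDerivative` takes arbitrary values, without meaning, on vector
fields which are not differentiable). -/
def SameConnection {V : Type*} [NormedAddCommGroup V] [NormedSpace ℝ V]
    {M : Type*} [TopologicalSpace M] [ChartedSpace V M] [IsManifold 𝓘(ℝ, V) ∞ M]
    (conn conn' : CovariantDerivative 𝓘(ℝ, V) V (TangentSpace 𝓘(ℝ, V) : M → Type _)) : Prop :=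
  ∀ (x : M) (Y : ∀ y : M, TangentSpace 𝓘(ℝ, V) y),
    MDifferentiableAt 𝓘(ℝ, V) 𝓘(ℝ, V).tangent
      (fun y => (⟨y, Y y⟩ : TangentBundle 𝓘(ℝ, V) M)) x →
    conn Y x = conn' Y x

end GStructures

/-! ### The group `GL(m, 𝒪)` -/

section Clifford

/-- The quadratic form on `ℝˢ ⊕ ℝᵗ` with `s` coefficients `+1` and `t` coefficients `-1`. -/
def signatureForm (s t : ℕ) : QuadraticForm ℝ (Fin s ⊕ Fin t → ℝ) :=
  QuadraticMap.weightedSumSquares ℝ (Sum.elim (fun _ => (1 : ℝ)) (fun _ => (-1 : ℝ)))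

/-- The Clifford algebra `𝒪 = 𝒞l(s,t)`: `s` generators of square `1` and `t` generators of square
`-1`, pairwise anticommuting. -/
abbrev Cl (s t : ℕ) : Type := CliffordAlgebra (signatureForm s t)

/-- The algebra generators of `𝒞l(s,t)`: the product unities `J_j` (indices in `Fin s`) and the
complex unities `I_i` (indices in `Fin t`). -/
def clGen {s t : ℕ} (i : Fin s ⊕ Fin t) : Cl s t :=
  CliffordAlgebra.ι (signatureForm s t) (Pi.single i 1)

/-- A check of the sign conventions. -/
theorem clGen_inl_sq {s t : ℕ} (j : Fin s) :
    (clGen (Sum.inl j) : Cl s t) * clGen (Sum.inl j) = 1 := by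
  have h : signatureForm s t (Pi.single (Sum.inl j) 1) = 1 := by
    simp [signatureForm, QuadraticMap.weightedSumSquares_apply, Pi.single_apply]
  rw [clGen, CliffordAlgebra.ι_sq_scalar, h, map_one]

/-- A check of the sign conventions. -/
theorem clGen_inr_sq {s t : ℕ} (i : Fin t) :
    (clGen (Sum.inr i) : Cl s t) * clGen (Sum.inr i) = -1 := by
  have h : signatureForm s t (Pi.single (Sum.inr i) 1) = -1 := by
    simp [signatureForm, QuadraticMap.weightedSumSquares_apply, Pi.single_apply]
  rw [clGen, CliffordAlgebra.ι_sq_scalar, h, map_neg, map_one]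

/-- The space `ℝ^{km}`, `k = 2^{s+t}`. -/
abbrev ClModel (s t m : ℕ) : Type := EuclideanSpace ℝ (Fin (2 ^ (s + t) * m))

/-- The affinor of `ℝ^{km}` given by a generator of `𝒪`, acting on `𝒪ᵐ` by left multiplication in
every component, where `ℝ^{km}` is identified with `𝒪ᵐ` by `e`. -/
def clAffinor {s t m : ℕ} (e : ClModel s t m ≃ₗ[ℝ] (Fin m → Cl s t)) (i : Fin s ⊕ Fin t)
    (v : ClModel s t m) : ClModel s t m :=
  e.symm (fun a => clGen i * e v a)

/-- `GL(m, 𝒪) = {B ∈ GL(km, ℝ) | B I_i = I_i B, B J_j = J_j B}`. -/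
def cliffordGL {s t m : ℕ} (e : ClModel s t m ≃ₗ[ℝ] (Fin m → Cl s t)) :
    Subgroup (ClModel s t m ≃L[ℝ] ClModel s t m) where
  carrier := {B | ∀ i v, B (clAffinor e i v) = clAffinor e i (B v)}
  one_mem' := fun _ _ => rfl
  mul_mem' := fun {a b} ha hb i v => by
    change a (b _) = clAffinor e i (a (b v))
    rw [hb, ha]
  inv_mem' := fun {a} ha i v => by
    change a.symm _ = clAffinor e i (a.symm v)
    rw [ContinuousLinearEquiv.symm_apply_eq, ha, a.apply_symm_apply]

end Clifford

end

/-!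
Write `𝔤` for the Lie algebra of `GL(m, 𝒪)`. Since the group consists of the invertible
endomorphisms commuting with the Clifford affinors, `𝔤` is the commutant of these affinors
(`linearLieAlgebra_eq_commutant`).

The algebraic core is that a symmetric bilinear map `B` which is linear over two anticommuting
invertible affinors `I` and `J` in one argument, hence in both, vanishes: `B(Iv, Jw)` equals both
`I J B(v, w)` and `J I B(v, w) = -I J B(v, w)` (`eq_zero_of_symm_of_anticommute`). So the first
prolongation of `𝔤` is zero. Equivalently, the operator `∂` is injective on `Hom(V, 𝔤)`, and the
decomposition `V ⊗ ⋀² V* = ∂(𝔤 ⊗ V*) ⊕ D` gives a linear map `ρ` assigning to every `c` in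
`V ⊗ ⋀² V*` the unique `φ` in `Hom(V, 𝔤)` with `∂ φ - c ∈ D` (`exists_spencer_correction`).

Let `s` be a local section of the `G`-structure, with structure function
`c(v, w) = s⁻¹ [s v, s w]`. If `φ` is the form of a connection in the frame `s`, its torsion
function at `s` is `∂ φ - c` (`IsSmoothLocalFrame.torsionFunction_eq`). A connection on the
`G`-structure with torsion in `D` therefore has the form `φ = ρ c` in every local section
(`GStructure.IsConnection.apply_frame`). This gives its uniqueness and, as `c` is smooth and `ρ`
linear, its smoothness.

For existence, the connection with form `ρ c` is taken around each point, for some local section.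
That it is a connection on the `G`-structure with torsion in `D` can be checked pointwise: a change
of section replaces the form `φ` by `g⁻¹ d g + g⁻¹ φ g`, where `g⁻¹ d g` lies in `𝔤` because `g`
commutes with the affinors (`IsSmoothLocalFrame.frameConnection_transition`), and `D` is
`G`-invariant. Uniqueness replaces a partition of unity, so
that no countability condition on `M` is needed.
-/

open scoped Manifold ContDiff

noncomputable section

/-! ### The Lie algebra of a commutant -/

section Commutant

variable {V : Type*} [NormedAddCommGroup V] [NormedSpace ℝ V]

/-- The endomorphisms of `V` commuting with every member of `K`. -/
def commutant (K : Set (V →L[ℝ] V)) : Submodule ℝ (V →L[ℝ] V) where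
  carrier := {A | ∀ J ∈ K, ∀ v, A (J v) = J (A v)}
  zero_mem' := fun J _ v => by simp
  add_mem' := fun ha hb J hJ v => by simp [ha J hJ v, hb J hJ v]
  smul_mem' := fun c _ ha J hJ v => by simp [ha J hJ v]

theorem mem_commutant {K : Set (V →L[ℝ] V)} {A : V →L[ℝ] V} :
    A ∈ commutant K ↔ ∀ J ∈ K, ∀ v, A (J v) = J (A v) := Iff.rfl

theorem commute_of_mem_commutant {K : Set (V →L[ℝ] V)} {A J : V →L[ℝ] V}
    (hA : A ∈ commutant K) (hJ : J ∈ K) : Commute A J :=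
  ContinuousLinearMap.ext fun v => hA J hJ v

/-- `G` consists of the invertible endomorphisms commuting with every member of `K`. -/
def IsCommutantGroup (G : Subgroup (V ≃L[ℝ] V)) (K : Set (V →L[ℝ] V)) : Prop :=
  ∀ g : V ≃L[ℝ] V, g ∈ G ↔ (g : V →L[ℝ] V) ∈ commutant K

/-- The inclusion of the Lie algebra in the commutant comes from differentiating
`exp (t A) J = J exp (t A)` at `t = 0`. -/
theorem linearLieAlgebra_eq_commutant [CompleteSpace V] {G : Subgroup (V ≃L[ℝ] V)}
    {K : Set (V →L[ℝ] V)} (hG : IsCommutantGroup G K) :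
    linearLieAlgebra G = commutant K := by
  apply le_antisymm
  · refine Submodule.span_le.2 fun A hA J hJ v => ?_
    have hexp : HasDerivAt (fun t : ℝ => NormedSpace.exp (t • A)) A 0 := by
      simpa using hasDerivAt_exp_smul_const (𝕂 := ℝ) A (0 : ℝ)
    have h1 : HasDerivAt (fun t : ℝ => NormedSpace.exp (t • A) * J) (A * J) 0 :=
      hexp.mul_const J
    have h2 : HasDerivAt (fun t : ℝ => J * NormedSpace.exp (t • A)) (J * A) 0 :=
      hexp.const_mul J
    have heq : (fun t : ℝ => NormedSpace.exp (t • A) * J)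
        = fun t : ℝ => J * NormedSpace.exp (t • A) := by
      funext t
      obtain ⟨g, hg, hgt⟩ := hA t
      rw [← hgt]
      exact commute_of_mem_commutant ((hG g).1 hg) hJ
    rw [heq] at h1
    exact congrArg (fun B : V →L[ℝ] V => B v) (h1.unique h2)
  · intro A hA
    refine Submodule.subset_span fun t => ?_
    have hinv : ∀ r : ℝ, NormedSpace.exp (r • A) * NormedSpace.exp ((-r) • A) = 1 := by
      intro r
      let _ := NormedAlgebra.restrictScalars ℚ ℝ (V →L[ℝ] V)
      rw [neg_smul, ← NormedSpace.exp_add_of_commute ((Commute.refl _).neg_right),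
        add_neg_cancel, NormedSpace.exp_zero]
    let g : V ≃L[ℝ] V := ContinuousLinearEquiv.equivOfInverse
      (NormedSpace.exp (t • A)) (NormedSpace.exp ((-t) • A))
      (fun v => by
        have := hinv (-t)
        rw [neg_neg] at this
        exact congrArg (fun B : V →L[ℝ] V => B v) this)
      (fun v => congrArg (fun B : V →L[ℝ] V => B v) (hinv t))
    refine ⟨g, (hG g).2 fun J hJ v => ?_, ContinuousLinearMap.ext fun v => rfl⟩
    have hc : Commute J (NormedSpace.exp (t • A)) :=
      ((commute_of_mem_commutant hA hJ).symm.smul_right t).exp_right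
    exact congrArg (fun B : V →L[ℝ] V => B v) hc.symm.eq

/-- Moving `I` and `J` out of different arguments in the two possible orders gives
`I J B(v, w) = J I B(v, w)`, hence `2 I J B(v, w) = 0` when `I` and `J` anticommute. -/
theorem eq_zero_of_symm_of_anticommute {I J : V →L[ℝ] V}
    (hIinj : Function.Injective I) (hJinj : Function.Injective J)
    (hanti : ∀ v, I (J v) = -J (I v)) {B : V → V → V} (hBI : ∀ v w, B v (I w) = I (B v w))
    (hBJ : ∀ v w, B v (J w) = J (B v w)) (hsymm : ∀ v w, B v w = B w v) (v w : V) :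
    B v w = 0 := by
  have hlI : ∀ v w, B (I v) w = I (B v w) := fun v w => by rw [hsymm, hBI, hsymm]
  have h1 : B (I v) (J w) = J (I (B v w)) := by rw [hBJ, hlI]
  have h2 : B (I v) (J w) = I (J (B v w)) := by rw [hlI, hBJ]
  have h3 : J (I (B v w)) = 0 := by
    have : J (I (B v w)) = -J (I (B v w)) := by rw [← hanti, ← h2, h1]
    rwa [eq_neg_iff_add_eq_zero, ← two_smul ℝ, smul_eq_zero_iff_right two_ne_zero] at this
  have h4 : I (B v w) = 0 := hJinj (h3.trans (map_zero J).symm)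
  exact hIinj (h4.trans (map_zero I).symm)

end Commutant

/-! ### Complements of the image of the Spencer operator -/

section Spencer

variable {V : Type*} [NormedAddCommGroup V] [NormedSpace ℝ V]

theorem spencer_apply (φ : V →L[ℝ] V →L[ℝ] V) (v w : V) :
    spencer V φ v w = φ v w - φ w v := rfl

/-- The kernel of the Spencer operator on `Hom(V, 𝔤)` is the first prolongation of `𝔤`, here
written with bilinear maps. -/
theorem spencer_injOn {𝔤 : Submodule ℝ (V →L[ℝ] V)}
    (h𝔤 : ∀ B : V →L[ℝ] V →L[ℝ] V, (∀ v, B v ∈ 𝔤) → (∀ v w, B v w = B w v) → B = 0) :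
    Set.InjOn (spencer V) (homInto 𝔤) := by
  intro φ hφ ψ hψ h
  refine sub_eq_zero.1 (h𝔤 _ (fun v => 𝔤.sub_mem (hφ v) (hψ v)) fun v w => ?_)
  have := congrArg (fun T : V →L[ℝ] V →L[ℝ] V => T v w) h
  simp only [spencer_apply] at this
  simp only [sub_apply]
  rwa [sub_eq_sub_iff_sub_eq_sub]

/-- If the Spencer operator is injective, the decomposition `V ⊗ ⋀² V* = ∂(𝔤 ⊗ V*) ⊕ D` yields a
linear map `ρ` which to a bilinear map `c` assigns the only `φ` in `𝔤 ⊗ V*` with `∂ φ - c` in `D`.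
The value of `ρ` on bilinear maps `c` which are not alternating has no meaning. -/
theorem exists_spencer_correction [FiniteDimensional ℝ V] {G : Subgroup (V ≃L[ℝ] V)}
    {D : Submodule ℝ (V →L[ℝ] V →L[ℝ] V)} (hD : IsInvariantComplement G D)
    (hinj : Set.InjOn (spencer V) (homInto (linearLieAlgebra G))) :
    ∃ ρ : (V →L[ℝ] V →L[ℝ] V) →ₗ[ℝ] (V →L[ℝ] V →L[ℝ] V),
      (∀ c ∈ torsionSpace V, ρ c ∈ homInto (linearLieAlgebra G) ∧ spencer V (ρ c) - c ∈ D) ∧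
      ∀ φ ∈ homInto (linearLieAlgebra G), ∀ c, spencer V φ - c ∈ D → φ = ρ c := by
  let H := homInto (linearLieAlgebra G)
  -- The map `ρ` is the first component of a left inverse of `(φ, d) ↦ ∂ φ - d`.
  let L : (H × D) →ₗ[ℝ] (V →L[ℝ] V →L[ℝ] V) :=
    (spencer V ∘ₗ H.subtype).coprod (-D.subtype)
  have hL : ∀ (φ : H) (d : D), L (φ, d) = spencer V φ - d := fun φ d => by
    simp [L, sub_eq_add_neg]
  have hker : LinearMap.ker L = ⊥ := by
    rw [LinearMap.ker_eq_bot']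
    rintro ⟨φ, d⟩ h
    rw [hL, sub_eq_zero] at h
    have hmem : spencer V φ ∈ (homInto (linearLieAlgebra G)).map (spencer V) ⊓ D :=
      ⟨⟨φ, φ.2, rfl⟩, h ▸ d.2⟩
    rw [hD.inf_eq, Submodule.mem_bot] at hmem
    have hφ : (φ : V →L[ℝ] V →L[ℝ] V) = 0 :=
      hinj φ.2 (Submodule.zero_mem _) (hmem.trans (map_zero _).symm)
    have hd : (d : V →L[ℝ] V →L[ℝ] V) = 0 := h.symm.trans hmem
    exact Prod.ext (Subtype.ext hφ) (Subtype.ext hd)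
  obtain ⟨R, hR⟩ : ∃ R : (V →L[ℝ] V →L[ℝ] V) →ₗ[ℝ] H × D, R ∘ₗ L = LinearMap.id :=
    LinearMap.exists_leftInverse_of_injective (K := ℝ) (V := H × D)
      (V' := V →L[ℝ] V →L[ℝ] V) L hker
  have hRL : ∀ p, R (L p) = p := fun p => congrArg (fun F => F p) hR
  have huniq : ∀ φ ∈ H, ∀ c, spencer V φ - c ∈ D →
      φ = (H.subtype ∘ₗ LinearMap.fst ℝ H D ∘ₗ R) c := by
    intro φ hφ c hc
    have h1 : L (⟨φ, hφ⟩, ⟨_, hc⟩) = c := by rw [hL]; simp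
    have h2 := hRL (⟨φ, hφ⟩, ⟨_, hc⟩)
    rw [h1] at h2
    simp [h2]
  refine ⟨H.subtype ∘ₗ LinearMap.fst ℝ H D ∘ₗ R, fun c hc => ?_, huniq⟩
  rw [← hD.sup_eq] at hc
  obtain ⟨_, ⟨φ, hφ, rfl⟩, d, hd, rfl⟩ := Submodule.mem_sup.1 hc
  have hφd : spencer V φ - (spencer V φ + d) ∈ D := by simpa using hd
  rw [← huniq φ hφ _ hφd]
  exact ⟨hφ, hφd⟩

end Spencer

/-! ### Clifford affinors and the type of `GL(m, 𝒪)` -/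

section Affinors

theorem clGen_mul_clGen_of_ne {s t : ℕ} {i j : Fin s ⊕ Fin t} (hij : i ≠ j) :
    (clGen i : Cl s t) * clGen j = -(clGen j * clGen i) := by
  have h : QuadraticMap.IsOrtho (signatureForm s t) (Pi.single i 1) (Pi.single j 1) := by
    rw [QuadraticMap.isOrtho_def]
    simp only [signatureForm, QuadraticMap.weightedSumSquares_apply, ← Finset.sum_add_distrib,
      ← smul_add]
    refine Finset.sum_congr rfl fun a _ => ?_
    by_cases hi : a = i
    · subst hi
      simp [hij]
    · simp [Pi.single_apply, hi]
  exact CliffordAlgebra.ι_mul_ι_comm_of_isOrtho h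

theorem clGen_sq {s t : ℕ} (i : Fin s ⊕ Fin t) :
    (clGen i : Cl s t) * clGen i = 1 ∨ (clGen i : Cl s t) * clGen i = -1 :=
  match i with
  | Sum.inl j => Or.inl (clGen_inl_sq j)
  | Sum.inr j => Or.inr (clGen_inr_sq j)

variable {s t m : ℕ} (e : ClModel s t m ≃ₗ[ℝ] (Fin m → Cl s t))

/-- The affinor `clAffinor e i` as a continuous linear map. -/
def clAffinorL (i : Fin s ⊕ Fin t) : ClModel s t m →L[ℝ] ClModel s t m :=
  LinearMap.toContinuousLinearMap
    { toFun := clAffinor e i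
      map_add' := fun v w => by
        rw [clAffinor, clAffinor, clAffinor, ← map_add]
        congr 1
        ext1 a
        simp [mul_add]
      map_smul' := fun c v => by
        rw [clAffinor, clAffinor, RingHom.id_apply, ← map_smul]
        congr 1
        ext1 a
        simp }

theorem apply_clAffinorL (i : Fin s ⊕ Fin t) (v : ClModel s t m) :
    e (clAffinorL e i v) = fun a => clGen i * e v a :=
  e.apply_symm_apply _

theorem clAffinorL_injective (i : Fin s ⊕ Fin t) : Function.Injective (clAffinorL e i) := by
  intro v w h
  apply e.injective
  have h' := congrArg e h
  rw [apply_clAffinorL, apply_clAffinorL] at h'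
  ext1 a
  have ha : clGen i * (clGen i * e v a) = clGen i * (clGen i * e w a) :=
    congrArg (clGen i * ·) (congrFun h' a)
  rw [← mul_assoc, ← mul_assoc] at ha
  rcases clGen_sq i with hi | hi <;> rw [hi] at ha <;> simpa using ha

theorem clAffinorL_anticommute {i j : Fin s ⊕ Fin t} (hij : i ≠ j) (v : ClModel s t m) :
    clAffinorL e i (clAffinorL e j v) = -clAffinorL e j (clAffinorL e i v) := by
  apply e.injective
  rw [map_neg, apply_clAffinorL, apply_clAffinorL]
  ext1 a
  rw [Pi.neg_apply, apply_clAffinorL, apply_clAffinorL]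
  simp only [← mul_assoc]
  rw [clGen_mul_clGen_of_ne hij, neg_mul]

theorem isCommutantGroup_cliffordGL :
    IsCommutantGroup (cliffordGL e) (Set.range (clAffinorL e)) := fun _ =>
  ⟨fun hg _ ⟨i, hi⟩ v => hi ▸ hg i v, fun hg i v => hg _ ⟨i, rfl⟩ v⟩

theorem linearLieAlgebra_cliffordGL :
    linearLieAlgebra (cliffordGL e) = commutant (Set.range (clAffinorL e)) :=
  linearLieAlgebra_eq_commutant (isCommutantGroup_cliffordGL e)

/-- The vanishing of the first prolongation of `𝔤𝔩(m, 𝒪)`; as soon as `s + t > 1` there are two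
different generators, and these anticommute. -/
theorem eq_zero_of_symm_of_mem_cliffordGL (hst : 1 < s + t)
    {B : ClModel s t m → ClModel s t m → ClModel s t m}
    (hB : ∀ v, ∃ A ∈ linearLieAlgebra (cliffordGL e), ∀ w, B v w = A w)
    (hsymm : ∀ v w, B v w = B w v) (v w : ClModel s t m) : B v w = 0 := by
  have : Nontrivial (Fin s ⊕ Fin t) := by
    rw [← Fintype.one_lt_card_iff_nontrivial]
    simpa using hst
  obtain ⟨i, j, hij⟩ := exists_pair_ne (Fin s ⊕ Fin t)
  have hlin : ∀ l v w, B v (clAffinorL e l w) = clAffinorL e l (B v w) := fun l v w => by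
    obtain ⟨A, hA, hBA⟩ := hB v
    rw [linearLieAlgebra_cliffordGL] at hA
    rw [hBA, hBA]
    exact hA _ ⟨l, rfl⟩ w
  exact eq_zero_of_symm_of_anticommute (clAffinorL_injective e i) (clAffinorL_injective e j)
    (clAffinorL_anticommute e hij) (hlin i) (hlin j) hsymm v w

theorem linearGroupIsOfType_cliffordGL (hst : 1 < s + t) (hm : 1 ≤ m) :
    LinearGroupIsOfType (cliffordGL e) 1 := by
  refine ⟨le_rfl, (Submodule.eq_bot_iff _).2 fun T hT => ?_, fun h => ?_⟩
  · ext1 v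
    have hv : v = ![v 0, v 1] := by ext1 i; fin_cases i <;> rfl
    rw [hv]
    refine eq_zero_of_symm_of_mem_cliffordGL e hst (B := fun x y => T ![x, y]) (fun x => ?_)
      (fun x y => ?_) _ _
    · refine ⟨T.toContinuousLinearMap ![x, 0] 1, hT.2 _ _, fun y => ?_⟩
      change _ = T (Function.update ![x, 0] 1 y)
      congr 1
      ext1 i
      fin_cases i <;> rfl
    · rw [← hT.1 (Equiv.swap 0 1)]
      congr 1
      ext1 i
      fin_cases i <;> rfl
  · -- The identity of `ℝ^{km}`, a nonzero space, is a nonzero element of the Lie algebra.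
    have hpos : 0 < 2 ^ (s + t) * m := by positivity
    have : Nonempty (Fin (2 ^ (s + t) * m)) := ⟨⟨0, hpos⟩⟩
    obtain ⟨v, hv⟩ := exists_ne (0 : ClModel s t m)
    let T := ContinuousMultilinearMap.ofSubsingleton ℝ (ClModel s t m) (ClModel s t m) (0 : Fin 1)
      (ContinuousLinearMap.id ℝ _)
    have hT : T ∈ prolongation (linearLieAlgebra (cliffordGL e)) 0 := by
      refine ⟨fun σ x => congrArg T (funext fun i => ?_), fun x i => ?_⟩
      · rw [Function.comp_apply, Fin.eq_zero (σ i), Fin.eq_zero i]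
      rw [linearLieAlgebra_cliffordGL]
      have : T.toContinuousLinearMap x i = ContinuousLinearMap.id ℝ _ := by
        ext1 w
        change Function.update x i w 0 = w
        rw [Fin.eq_zero i, Function.update_self]
      rw [this]
      exact fun _ _ _ => rfl
    rw [show (1 : ℕ) - 1 = 0 from rfl] at h
    rw [h, Submodule.mem_bot] at hT
    exact hv (congrArg (fun S => S fun _ => v) hT)

end Affinors

/-! ### Smooth functions with values in a space of linear maps -/

section LinearMapValued

theorem contMDiffAt_linearMap_comp {V : Type*} [NormedAddCommGroup V] [NormedSpace ℝ V]
    {M : Type*} [TopologicalSpace M] [ChartedSpace V M]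
    {E W : Type*} [NormedAddCommGroup E] [NormedSpace ℝ E] [FiniteDimensional ℝ E]
    [NormedAddCommGroup W] [NormedSpace ℝ W] (L : E →ₗ[ℝ] W)
    {f : M → E} {x : M} {n : ℕ∞ω} (hf : ContMDiffAt 𝓘(ℝ, V) 𝓘(ℝ, E) n f x) :
    ContMDiffAt 𝓘(ℝ, V) 𝓘(ℝ, W) n (fun y => L (f y)) x :=
  (LinearMap.toContinuousLinearMap L).contMDiff.contMDiffAt.comp x hf

variable {V : Type*} [NormedAddCommGroup V] [NormedSpace ℝ V] [FiniteDimensional ℝ V]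
  {M : Type*} [TopologicalSpace M] [ChartedSpace V M]

theorem contMDiffAt_clm_of_apply {W : Type*} [NormedAddCommGroup W] [NormedSpace ℝ W]
    {f : M → V →L[ℝ] W} {x : M} {n : ℕ∞ω}
    (h : ∀ v, ContMDiffAt 𝓘(ℝ, V) 𝓘(ℝ, W) n (fun y => f y v) x) :
    ContMDiffAt 𝓘(ℝ, V) 𝓘(ℝ, V →L[ℝ] W) n f x := by
  let b := Module.finBasis ℝ V
  let κ : ∀ i, V →L[ℝ] ℝ := fun i => LinearMap.toContinuousLinearMap (b.coord i)
  have hf : f = fun y => ∑ i, ContinuousLinearMap.smulRightL ℝ V W (κ i) (f y (b i)) := by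
    funext y
    ext1 v
    conv_lhs => rw [← b.sum_repr v, map_sum]
    simp [κ]
  rw [hf]
  exact ContMDiffAt.sum fun i _ => (ContinuousLinearMap.contMDiff _).contMDiffAt.comp x (h (b i))

theorem ContMDiffAt.clm_inverse {f : M → V →L[ℝ] V} {x : M} {n : ℕ∞ω}
    (hf : ContMDiffAt 𝓘(ℝ, V) 𝓘(ℝ, V →L[ℝ] V) n f x) (A : V ≃L[ℝ] V) (hA : f x = A) :
    ContMDiffAt 𝓘(ℝ, V) 𝓘(ℝ, V →L[ℝ] V) n (fun y => (f y).inverse) x := by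
  have : CompleteSpace V := FiniteDimensional.complete ℝ V
  have h : ContDiffAt ℝ n (ContinuousLinearMap.inverse (R := ℝ) (M := V) (M₂ := V)) (f x) :=
    hA ▸ contDiffAt_map_inverse A
  exact h.contMDiffAt.comp x hf

end LinearMapValued

/-! ### Smooth local frames -/

section SmoothFrames

open Bundle Topology

variable {V : Type*} [NormedAddCommGroup V] [NormedSpace ℝ V]
  {M : Type*} [TopologicalSpace M] [ChartedSpace V M] [IsManifold 𝓘(ℝ, V) ∞ M]

/-- The frame `s y` read in the trivialization of the tangent bundle around `x`; it is `0` for `y`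
outside the base set of this trivialization. -/
def frameCoord (s : ∀ y : M, V ≃L[ℝ] TangentSpace 𝓘(ℝ, V) y) (x y : M) : V →L[ℝ] V :=
  (trivializationAt V (TangentSpace 𝓘(ℝ, V)) x).continuousLinearMapAt ℝ y ∘L
    (s y : V →L[ℝ] TangentSpace 𝓘(ℝ, V) y)

/-- `frameCoord s x y`, as an equivalence, for `y` close to `x`. -/
def frameCoordEquiv (s : ∀ y : M, V ≃L[ℝ] TangentSpace 𝓘(ℝ, V) y) {x y : M}
    (hy : y ∈ (trivializationAt V (TangentSpace 𝓘(ℝ, V)) x).baseSet) : V ≃L[ℝ] V :=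
  (s y).trans
    ((trivializationAt V (TangentSpace 𝓘(ℝ, V)) x).continuousLinearEquivAt ℝ y hy)

variable {s : ∀ y : M, V ≃L[ℝ] TangentSpace 𝓘(ℝ, V) y} {U : Set M} {x : M}

theorem frameCoord_eq {y : M}
    (hy : y ∈ (trivializationAt V (TangentSpace 𝓘(ℝ, V)) x).baseSet) :
    frameCoord s x y = frameCoordEquiv s hy := by
  rw [frameCoord, ← Trivialization.coe_continuousLinearEquivAt_eq' _ hy]
  rfl

theorem frameCoordEquiv_symm_apply (Y : ∀ y : M, TangentSpace 𝓘(ℝ, V) y) {y : M}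
    (hy : y ∈ (trivializationAt V (TangentSpace 𝓘(ℝ, V)) x).baseSet) :
    (s y).symm (Y y) = (frameCoordEquiv s hy).symm
      (trivializationAt V (TangentSpace 𝓘(ℝ, V)) x ⟨y, Y y⟩).2 := by
  rw [ContinuousLinearEquiv.eq_symm_apply]
  change Trivialization.continuousLinearEquivAt ℝ _ y hy (s y ((s y).symm (Y y))) = _
  rw [ContinuousLinearEquiv.apply_symm_apply]
  rfl

theorem eventually_mem_baseSet (x : M) :
    ∀ᶠ y in 𝓝 x, y ∈ (trivializationAt V (TangentSpace 𝓘(ℝ, V)) x).baseSet :=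
  (trivializationAt V (TangentSpace 𝓘(ℝ, V)) x).open_baseSet.mem_nhds
    (FiberBundle.mem_baseSet_trivializationAt' x)

theorem IsSmoothLocalFrame.contMDiffAt_apply (hs : IsSmoothLocalFrame s U) (hU : IsOpen U)
    (hx : x ∈ U) (v : V) :
    ContMDiffAt 𝓘(ℝ, V) 𝓘(ℝ, V).tangent ∞
      (fun y => (⟨y, s y v⟩ : TangentBundle 𝓘(ℝ, V) M)) x :=
  (hs v).contMDiffAt (hU.mem_nhds hx)

theorem IsSmoothLocalFrame.mdifferentiableAt_apply (hs : IsSmoothLocalFrame s U) (hU : IsOpen U)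
    (hx : x ∈ U) (v : V) :
    MDifferentiableAt 𝓘(ℝ, V) 𝓘(ℝ, V).tangent
      (fun y => (⟨y, s y v⟩ : TangentBundle 𝓘(ℝ, V) M)) x :=
  (hs.contMDiffAt_apply hU hx v).mdifferentiableAt (by simp)

theorem eventually_symm_eq_frameCoord_inverse (s : ∀ y : M, V ≃L[ℝ] TangentSpace 𝓘(ℝ, V) y)
    (x : M) (Y : ∀ y : M, TangentSpace 𝓘(ℝ, V) y) :
    ∀ᶠ y in 𝓝 x, (s y).symm (Y y) = (frameCoord s x y).inverse
      (trivializationAt V (TangentSpace 𝓘(ℝ, V)) x ⟨y, Y y⟩).2 := by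
  filter_upwards [eventually_mem_baseSet (V := V) x] with y hy
  rw [frameCoordEquiv_symm_apply Y hy, frameCoord_eq hy, ContinuousLinearMap.inverse_equiv]
  rfl

/-- The derivative of a smooth function along a smooth vector field is smooth. -/
theorem ContMDiffAt.mvfderiv_apply {f : M → V}
    (hf : ContMDiffAt 𝓘(ℝ, V) 𝓘(ℝ, V) ∞ f x) {Y : ∀ y : M, TangentSpace 𝓘(ℝ, V) y}
    (hY : ContMDiffAt 𝓘(ℝ, V) 𝓘(ℝ, V).tangent ∞
      (fun y => (⟨y, Y y⟩ : TangentBundle 𝓘(ℝ, V) M)) x) :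
    ContMDiffAt 𝓘(ℝ, V) 𝓘(ℝ, V) ∞ (fun y => mvfderiv 𝓘(ℝ, V) f y (Y y)) x := by
  have h1 := hf.mfderiv_const (m := ∞) (by simp)
  have h2 : ContMDiffAt 𝓘(ℝ, V) 𝓘(ℝ, V).tangent ∞
      (fun y => (⟨f y, mfderiv 𝓘(ℝ, V) 𝓘(ℝ, V) f y (Y y)⟩ : TangentBundle 𝓘(ℝ, V) V)) x :=
    ContMDiffAt.clm_apply_of_inCoordinates (b₁ := id) h1 hY hf
  exact (contMDiff_snd_tangentBundle_modelSpace V 𝓘(ℝ, V)).contMDiffAt.comp x h2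

variable [FiniteDimensional ℝ V]

theorem IsSmoothLocalFrame.contMDiffAt_frameCoord (hs : IsSmoothLocalFrame s U) (hU : IsOpen U)
    (hx : x ∈ U) : ContMDiffAt 𝓘(ℝ, V) 𝓘(ℝ, V →L[ℝ] V) ∞ (frameCoord s x) x := by
  refine contMDiffAt_clm_of_apply fun v => ?_
  refine ((contMDiffAt_section x).1 (hs.contMDiffAt_apply hU hx v)).congr_of_eventuallyEq ?_
  filter_upwards [eventually_mem_baseSet (V := V) x] with y hy
  rw [frameCoord_eq hy]
  rfl

theorem IsSmoothLocalFrame.contMDiffAt_frameCoord_inverse (hs : IsSmoothLocalFrame s U)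
    (hU : IsOpen U) (hx : x ∈ U) :
    ContMDiffAt 𝓘(ℝ, V) 𝓘(ℝ, V →L[ℝ] V) ∞ (fun y => (frameCoord s x y).inverse) x :=
  (hs.contMDiffAt_frameCoord hU hx).clm_inverse _
    (frameCoord_eq (FiberBundle.mem_baseSet_trivializationAt' x))

theorem IsSmoothLocalFrame.contMDiffAt_symm_apply (hs : IsSmoothLocalFrame s U) (hU : IsOpen U)
    (hx : x ∈ U) {Y : ∀ y : M, TangentSpace 𝓘(ℝ, V) y}
    (hY : ContMDiffAt 𝓘(ℝ, V) 𝓘(ℝ, V).tangent ∞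
      (fun y => (⟨y, Y y⟩ : TangentBundle 𝓘(ℝ, V) M)) x) :
    ContMDiffAt 𝓘(ℝ, V) 𝓘(ℝ, V) ∞ (fun y => (s y).symm (Y y)) x :=
  ((hs.contMDiffAt_frameCoord_inverse hU hx).clm_apply
    ((contMDiffAt_section x).1 hY)).congr_of_eventuallyEq
      (eventually_symm_eq_frameCoord_inverse s x Y)

theorem IsSmoothLocalFrame.mdifferentiableAt_symm_apply (hs : IsSmoothLocalFrame s U)
    (hU : IsOpen U) (hx : x ∈ U) {Y : ∀ y : M, TangentSpace 𝓘(ℝ, V) y}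
    (hY : MDifferentiableAt 𝓘(ℝ, V) 𝓘(ℝ, V).tangent
      (fun y => (⟨y, Y y⟩ : TangentBundle 𝓘(ℝ, V) M)) x) :
    MDifferentiableAt 𝓘(ℝ, V) 𝓘(ℝ, V) (fun y => (s y).symm (Y y)) x :=
  (((hs.contMDiffAt_frameCoord_inverse hU hx).mdifferentiableAt (by simp)).clm_apply
    ((mdifferentiableAt_section _ _).1 hY)).congr_of_eventuallyEq
      (eventually_symm_eq_frameCoord_inverse s x Y)

/-- A field of endomorphisms of the tangent spaces is smooth if its matrix with respect to a smooth
local frame is. -/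
theorem IsSmoothLocalFrame.contMDiffAt_endomorphism (hs : IsSmoothLocalFrame s U) (hU : IsOpen U)
    (hx : x ∈ U) {θ : ∀ y : M, TangentSpace 𝓘(ℝ, V) y →L[ℝ] TangentSpace 𝓘(ℝ, V) y}
    (hθ : ∀ v : V, ContMDiffAt 𝓘(ℝ, V) 𝓘(ℝ, V) ∞ (fun y => (s y).symm (θ y (s y v))) x) :
    ContMDiffAt 𝓘(ℝ, V) (𝓘(ℝ, V).prod 𝓘(ℝ, V →L[ℝ] V)) ∞
      (fun y => (⟨y, θ y⟩ : TotalSpace (V →L[ℝ] V)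
        fun y : M => TangentSpace 𝓘(ℝ, V) y →L[ℝ] TangentSpace 𝓘(ℝ, V) y)) x := by
  rw [contMDiffAt_hom_bundle]
  refine ⟨contMDiffAt_id, ?_⟩
  let N : M → V →L[ℝ] V := fun y =>
    ((s y).symm : TangentSpace 𝓘(ℝ, V) y →L[ℝ] V) ∘L θ y ∘L
      (s y : V →L[ℝ] TangentSpace 𝓘(ℝ, V) y)
  have hN : ContMDiffAt 𝓘(ℝ, V) 𝓘(ℝ, V →L[ℝ] V) ∞ N x := contMDiffAt_clm_of_apply hθ
  refine ((hs.contMDiffAt_frameCoord hU hx).clm_comp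
    (hN.clm_comp (hs.contMDiffAt_frameCoord_inverse hU hx))).congr_of_eventuallyEq ?_
  filter_upwards [eventually_mem_baseSet (V := V) x] with y hy
  rw [ContinuousLinearMap.inCoordinates_eq hy hy, frameCoord_eq hy,
    ContinuousLinearMap.inverse_equiv]
  ext1 v
  simp [N, frameCoordEquiv]

end SmoothFrames

/-! ### Connections in a local frame -/

section FrameConnections

open Bundle Topology

variable {V : Type*} [NormedAddCommGroup V] [NormedSpace ℝ V]
  {M : Type*} [TopologicalSpace M] [ChartedSpace V M]

/-- The connection whose form with respect to the frame `s` is `X ↦ φ (s⁻¹ X)`: it sends the vector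
field `s f` to `s (d f + φ (s⁻¹ ·) f)`. -/
def frameConnection (s : ∀ y : M, V ≃L[ℝ] TangentSpace 𝓘(ℝ, V) y) (φ : M → V →L[ℝ] V →L[ℝ] V)
    (Y : ∀ y : M, TangentSpace 𝓘(ℝ, V) y) (x : M) :
    TangentSpace 𝓘(ℝ, V) x →L[ℝ] TangentSpace 𝓘(ℝ, V) x :=
  (s x : V →L[ℝ] TangentSpace 𝓘(ℝ, V) x) ∘L
    (mvfderiv 𝓘(ℝ, V) (fun y => (s y).symm (Y y)) x +
      (φ x).flip ((s x).symm (Y x)) ∘L ((s x).symm : TangentSpace 𝓘(ℝ, V) x →L[ℝ] V))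

variable {s : ∀ y : M, V ≃L[ℝ] TangentSpace 𝓘(ℝ, V) y} {U : Set M} {x : M}

theorem frameConnection_apply (φ : M → V →L[ℝ] V →L[ℝ] V)
    (Y : ∀ y : M, TangentSpace 𝓘(ℝ, V) y) (X : TangentSpace 𝓘(ℝ, V) x) :
    frameConnection s φ Y x X = s x (mvfderiv 𝓘(ℝ, V) (fun y => (s y).symm (Y y)) x X +
      φ x ((s x).symm X) ((s x).symm (Y x))) := rfl

theorem frameConnection_frame (φ : M → V →L[ℝ] V →L[ℝ] V) (w : V)
    (X : TangentSpace 𝓘(ℝ, V) x) :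
    frameConnection s φ (fun y => s y w) x X = s x (φ x ((s x).symm X) w) := by
  simp only [frameConnection_apply, ContinuousLinearEquiv.symm_apply_apply]
  rw [mvfderiv_const, zero_apply, zero_add]

theorem mvfderiv_clm_comp {W : Type*} [NormedAddCommGroup W] [NormedSpace ℝ W] (L : V →L[ℝ] W)
    {f : M → V} (hf : MDifferentiableAt 𝓘(ℝ, V) 𝓘(ℝ, V) f x) (X : TangentSpace 𝓘(ℝ, V) x) :
    mvfderiv 𝓘(ℝ, V) (fun y => L (f y)) x X = L (mvfderiv 𝓘(ℝ, V) f x X) := by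
  have h := (L.hasMFDerivAt (x := f x)).comp x hf.hasMFDerivAt
  exact congrArg (fun B : TangentSpace 𝓘(ℝ, V) x →L[ℝ] W => B X) h.mfderiv

theorem mvfderiv_congr {f g : M → V} (h : f =ᶠ[𝓝 x] g) (X : TangentSpace 𝓘(ℝ, V) x) :
    mvfderiv 𝓘(ℝ, V) f x X = mvfderiv 𝓘(ℝ, V) g x X :=
  congrArg (fun B : V →L[ℝ] V => B X) h.mfderiv_eq

variable [IsManifold 𝓘(ℝ, V) ∞ M] [FiniteDimensional ℝ V]

theorem IsSmoothLocalFrame.isCovariantDerivativeOn (hs : IsSmoothLocalFrame s U) (hU : IsOpen U)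
    (φ : M → V →L[ℝ] V →L[ℝ] V) : IsCovariantDerivativeOn V (frameConnection s φ) U where
  add {Y Y' x} hY hY' hx := by
    ext1 X
    have hadd : (fun y => (s y).symm ((Y + Y') y)) =
        (fun y => (s y).symm (Y y)) + fun y => (s y).symm (Y' y) := by
      funext y
      simp
    rw [add_apply, frameConnection_apply, frameConnection_apply, frameConnection_apply, hadd,
      mvfderiv_add (hs.mdifferentiableAt_symm_apply hU hx hY)
        (hs.mdifferentiableAt_symm_apply hU hx hY'), ← map_add]
    congr 1
    simp only [add_apply, Pi.add_apply, map_add]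
    abel
  leibniz {Y g x} hY hg hx := by
    ext1 X
    have hsmul : (fun y => (s y).symm ((g • Y) y)) = g • fun y => (s y).symm (Y y) := by
      funext y
      simp
    have hval : Y x = s x ((s x).symm (Y x)) := ((s x).apply_symm_apply _).symm
    rw [add_apply, smul_apply, ContinuousLinearMap.smulRight_apply, frameConnection_apply,
      frameConnection_apply, hsmul, mvfderiv_smul hg (hs.mdifferentiableAt_symm_apply hU hx hY)]
    conv_rhs => rw [hval]
    rw [← map_smul, ← map_smul, ← map_add]
    congr 1
    simp only [add_apply, smul_apply, ContinuousLinearMap.smulRight_apply, Pi.smul_apply',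
      map_smul, smul_add, ContinuousLinearEquiv.apply_symm_apply]
    abel

/-- A connection is determined at a point by its values on the vector fields of a local frame. -/
theorem IsSmoothLocalFrame.covariantDerivative_eq (hs : IsSmoothLocalFrame s U) (hU : IsOpen U)
    {cov cov' : (∀ y : M, TangentSpace 𝓘(ℝ, V) y) →
      ∀ y : M, TangentSpace 𝓘(ℝ, V) y →L[ℝ] TangentSpace 𝓘(ℝ, V) y}
    (hcov : IsCovariantDerivativeOn V cov U) (hcov' : IsCovariantDerivativeOn V cov' U)
    (hx : x ∈ U) (h : ∀ v, cov (fun y => s y v) x = cov' (fun y => s y v) x)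
    {Y : ∀ y : M, TangentSpace 𝓘(ℝ, V) y}
    (hY : MDifferentiableAt 𝓘(ℝ, V) 𝓘(ℝ, V).tangent
      (fun y => (⟨y, Y y⟩ : TangentBundle 𝓘(ℝ, V) M)) x) :
    cov Y x = cov' Y x := by
  let v := (s x).symm (Y x)
  have h1 := hcov.difference_apply hcov' hx hY
  have h2 := hcov.difference_apply hcov' hx (hs.mdifferentiableAt_apply hU hx v)
  rw [h, sub_self, ContinuousLinearEquiv.apply_symm_apply] at h2
  exact sub_eq_zero.1 (h1.symm.trans h2)

/-- The components `s⁻¹ [s v, s w]` of the Lie bracket in the frame `s`, a bilinear function of `v`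
and `w` where the frame is differentiable; elsewhere the value `0` is assigned. -/
def structureFunction (s : ∀ y : M, V ≃L[ℝ] TangentSpace 𝓘(ℝ, V) y) (x : M) :
    V →L[ℝ] V →L[ℝ] V :=
  haveI : CompleteSpace V := FiniteDimensional.complete ℝ V
  open Classical in
  if h : ∀ v : V, MDifferentiableAt 𝓘(ℝ, V) 𝓘(ℝ, V).tangent
      (fun y => (⟨y, s y v⟩ : TangentBundle 𝓘(ℝ, V) M)) x then
    (LinearMap.mk₂ ℝ
      (fun v w => (s x).symm
        (VectorField.mlieBracket 𝓘(ℝ, V) (fun y => s y v) (fun y => s y w) x))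
      (fun v v' w => by
        rw [← map_add, ← VectorField.mlieBracket_add_left (h v) (h v')]
        simp only [map_add]
        rfl)
      (fun c v w => by
        rw [← map_smul, ← VectorField.mlieBracket_const_smul_left (h v)]
        simp only [map_smul]
        rfl)
      (fun v w w' => by
        rw [← map_add, ← VectorField.mlieBracket_add_right (h w) (h w')]
        simp only [map_add]
        rfl)
      (fun c v w => by
        rw [← map_smul, ← VectorField.mlieBracket_const_smul_right (h w)]
        simp only [map_smul]
        rfl)).toContinuousBilinearMap
  else 0

theorem IsSmoothLocalFrame.structureFunction_apply (hs : IsSmoothLocalFrame s U) (hU : IsOpen U)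
    (hx : x ∈ U) (v w : V) :
    structureFunction s x v w = (s x).symm
      (VectorField.mlieBracket 𝓘(ℝ, V) (fun y => s y v) (fun y => s y w) x) := by
  rw [structureFunction, dif_pos (hs.mdifferentiableAt_apply hU hx)]
  rfl

theorem IsSmoothLocalFrame.structureFunction_mem (hs : IsSmoothLocalFrame s U) (hU : IsOpen U)
    (hx : x ∈ U) : structureFunction s x ∈ torsionSpace V := by
  intro v
  rw [hs.structureFunction_apply hU hx, VectorField.mlieBracket_self]
  exact map_zero _

theorem IsSmoothLocalFrame.contMDiffAt_structureFunction (hs : IsSmoothLocalFrame s U)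
    (hU : IsOpen U) (hx : x ∈ U) :
    ContMDiffAt 𝓘(ℝ, V) 𝓘(ℝ, V →L[ℝ] V →L[ℝ] V) ∞ (structureFunction s) x := by
  have : CompleteSpace V := FiniteDimensional.complete ℝ V
  refine contMDiffAt_clm_of_apply fun v => contMDiffAt_clm_of_apply fun w => ?_
  have : IsManifold 𝓘(ℝ, V) (((⊤ : ℕ∞) : ℕ∞ω) + 1) M :=
    IsManifold.of_le (n := ∞) (by simp)
  have : IsManifold 𝓘(ℝ, V) (minSmoothness ℝ 2) M := by
    rw [minSmoothness_of_isRCLikeNormedField]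
    infer_instance
  have hbr : ContMDiffAt 𝓘(ℝ, V) 𝓘(ℝ, V).tangent ∞ (fun y => (⟨y, VectorField.mlieBracket 𝓘(ℝ, V)
      (fun y => s y v) (fun y => s y w) y⟩ : TangentBundle 𝓘(ℝ, V) M)) x :=
    ContMDiffAt.mlieBracket_vectorField (m := ⊤) (n := ⊤) (hs.contMDiffAt_apply hU hx v)
      (hs.contMDiffAt_apply hU hx w) (by simp)
  refine (hs.contMDiffAt_symm_apply hU hx hbr).congr_of_eventuallyEq ?_
  filter_upwards [hU.mem_nhds hx] with y hy
  exact hs.structureFunction_apply hU hy v w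

theorem torsionFunction_apply
    (conn : CovariantDerivative 𝓘(ℝ, V) V (TangentSpace 𝓘(ℝ, V) : M → Type _))
    (u : V ≃L[ℝ] TangentSpace 𝓘(ℝ, V) x) (v w : V) :
    torsionFunction conn u v w =
      haveI : CompleteSpace V := FiniteDimensional.complete ℝ V
      u.symm (conn.torsion x (u v) (u w)) := rfl

/-- The first structure equation in the frame `s`. -/
theorem IsSmoothLocalFrame.torsionFunction_eq (hs : IsSmoothLocalFrame s U) (hU : IsOpen U)
    (hx : x ∈ U) (conn : CovariantDerivative 𝓘(ℝ, V) V (TangentSpace 𝓘(ℝ, V) : M → Type _))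
    {φ : V →L[ℝ] V →L[ℝ] V} (hφ : ∀ v w, conn (fun y => s y w) x (s x v) = s x (φ v w)) :
    torsionFunction conn (s x) = spencer V φ - structureFunction s x := by
  have : CompleteSpace V := FiniteDimensional.complete ℝ V
  ext1 v
  ext1 w
  rw [torsionFunction_apply, conn.torsion_apply (X := fun y => s y v) (Y := fun y => s y w)
    (hs.mdifferentiableAt_apply hU hx v) (hs.mdifferentiableAt_apply hU hx w), hφ, hφ, map_sub,
    map_sub, ← hs.structureFunction_apply hU hx]
  simp [spencer_apply]

theorem torsionFunction_trans
    (conn : CovariantDerivative 𝓘(ℝ, V) V (TangentSpace 𝓘(ℝ, V) : M → Type _))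
    (u : V ≃L[ℝ] TangentSpace 𝓘(ℝ, V) x) (g : V ≃L[ℝ] V) :
    torsionFunction conn (g.trans u) =
      g.symm.arrowCongr (g.symm.arrowCongr g.symm) (torsionFunction conn u) := rfl

/-- If the connection form in the frame `s` is smooth, so is the connection. -/
theorem IsSmoothLocalFrame.contMDiffAt_frameConnection (hs : IsSmoothLocalFrame s U)
    (hU : IsOpen U) (hx : x ∈ U) {φ : M → V →L[ℝ] V →L[ℝ] V}
    (hφ : ContMDiffAt 𝓘(ℝ, V) 𝓘(ℝ, V →L[ℝ] V →L[ℝ] V) ∞ φ x)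
    {Y : ∀ y : M, TangentSpace 𝓘(ℝ, V) y}
    (hY : ContMDiffAt 𝓘(ℝ, V) 𝓘(ℝ, V).tangent ∞
      (fun y => (⟨y, Y y⟩ : TangentBundle 𝓘(ℝ, V) M)) x) :
    ContMDiffAt 𝓘(ℝ, V) (𝓘(ℝ, V).prod 𝓘(ℝ, V →L[ℝ] V)) ∞
      (fun y => (⟨y, frameConnection s φ Y y⟩ : TotalSpace (V →L[ℝ] V)
        fun y : M => TangentSpace 𝓘(ℝ, V) y →L[ℝ] TangentSpace 𝓘(ℝ, V) y)) x := by
  refine hs.contMDiffAt_endomorphism hU hx fun v => ?_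
  have hf := hs.contMDiffAt_symm_apply hU hx hY
  have h := (hf.mvfderiv_apply (hs.contMDiffAt_apply hU hx v)).add
    ((hφ.clm_apply (contMDiffAt_const (c := v))).clm_apply hf)
  refine h.congr_of_eventuallyEq (Filter.Eventually.of_forall fun y => ?_)
  simp [frameConnection_apply]

end FrameConnections

/-! ### Connections with prescribed torsion on a `G`-structure -/

section DConnections

open Bundle Topology

variable {V : Type*} [NormedAddCommGroup V] [NormedSpace ℝ V] [FiniteDimensional ℝ V]
  {G : Subgroup (V ≃L[ℝ] V)}
  {M : Type*} [TopologicalSpace M] [ChartedSpace V M] [IsManifold 𝓘(ℝ, V) ∞ M]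
  {P : GStructure G M} {D : Submodule ℝ (V →L[ℝ] V →L[ℝ] V)}
  {conn : CovariantDerivative 𝓘(ℝ, V) V (TangentSpace 𝓘(ℝ, V) : M → Type _)}
  {s s' : ∀ y : M, V ≃L[ℝ] TangentSpace 𝓘(ℝ, V) y} {U U' : Set M} {x : M}

theorem GStructure.IsConnection.exists_form (hconn : P.IsConnection conn) (hU : IsOpen U)
    (hs : IsSmoothLocalFrame s U) (hsP : ∀ y ∈ U, s y ∈ P.frames y) (hx : x ∈ U) :
    ∃ φ ∈ homInto (linearLieAlgebra G),
      ∀ v w, conn (fun y => s y w) x (s x v) = s x (φ v w) := by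
  choose A hA hconnA using fun v => hconn U s hU hs hsP x hx (s x v)
  let φ : V →ₗ[ℝ] V →L[ℝ] V :=
    { toFun := A
      map_add' := fun v v' => by
        ext1 w
        apply (s x).injective
        rw [add_apply, map_add, ← hconnA, ← hconnA, ← hconnA, map_add, map_add]
      map_smul' := fun c v => by
        ext1 w
        apply (s x).injective
        rw [smul_apply, map_smul, ← hconnA, ← hconnA, map_smul, map_smul]
        rfl }
  exact ⟨LinearMap.toContinuousLinearMap φ, hA, hconnA⟩

/-- In a local section `s` of `P`, the form `φ` of a connection with torsion in `D` solves
`∂ φ - c ∈ D`, where `c` is the structure function of `s`; so it is the solution chosen by `ρ`. -/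
theorem GStructure.IsConnection.apply_frame (hconn : P.IsConnection conn)
    (htor : ∀ (x : M), ∀ u ∈ P.frames x, torsionFunction conn u ∈ D)
    {ρ : (V →L[ℝ] V →L[ℝ] V) →ₗ[ℝ] (V →L[ℝ] V →L[ℝ] V)}
    (hρ : ∀ φ ∈ homInto (linearLieAlgebra G), ∀ c, spencer V φ - c ∈ D → φ = ρ c)
    (hU : IsOpen U) (hs : IsSmoothLocalFrame s U) (hsP : ∀ y ∈ U, s y ∈ P.frames y)
    (hx : x ∈ U) (w : V) :
    conn (fun y => s y w) x =
      frameConnection s (fun y => ρ (structureFunction s y)) (fun y => s y w) x := by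
  obtain ⟨φ, hφ, hconnφ⟩ := hconn.exists_form hU hs hsP hx
  have hmem := htor x (s x) (hsP x hx)
  rw [hs.torsionFunction_eq hU hx conn hconnφ] at hmem
  ext1 X
  rw [frameConnection_frame, ← hρ φ hφ _ hmem, ← hconnφ, ContinuousLinearEquiv.apply_symm_apply]

theorem GStructure.IsConnection.eq_frameConnection (hconn : P.IsConnection conn)
    (htor : ∀ (x : M), ∀ u ∈ P.frames x, torsionFunction conn u ∈ D)
    {ρ : (V →L[ℝ] V →L[ℝ] V) →ₗ[ℝ] (V →L[ℝ] V →L[ℝ] V)}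
    (hρ : ∀ φ ∈ homInto (linearLieAlgebra G), ∀ c, spencer V φ - c ∈ D → φ = ρ c)
    (hU : IsOpen U) (hs : IsSmoothLocalFrame s U) (hsP : ∀ y ∈ U, s y ∈ P.frames y)
    (hx : x ∈ U) {Y : ∀ y : M, TangentSpace 𝓘(ℝ, V) y}
    (hY : MDifferentiableAt 𝓘(ℝ, V) 𝓘(ℝ, V).tangent
      (fun y => (⟨y, Y y⟩ : TangentBundle 𝓘(ℝ, V) M)) x) :
    conn Y x = frameConnection s (fun y => ρ (structureFunction s y)) Y x :=
  hs.covariantDerivative_eq hU conn.isCovariantDerivativeOn (hs.isCovariantDerivativeOn hU _) hx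
    (hconn.apply_frame htor hρ hU hs hsP hx) hY

/-- Uniqueness: in a local section of `P` both connections have the form `ρ c`. -/
theorem GStructure.IsDConnection.sameConnection
    {conn' : CovariantDerivative 𝓘(ℝ, V) V (TangentSpace 𝓘(ℝ, V) : M → Type _)}
    {ρ : (V →L[ℝ] V →L[ℝ] V) →ₗ[ℝ] (V →L[ℝ] V →L[ℝ] V)}
    (hρ : ∀ φ ∈ homInto (linearLieAlgebra G), ∀ c, spencer V φ - c ∈ D → φ = ρ c)
    (hconn : P.IsDConnection D conn) (hconn' : P.IsDConnection D conn') :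
    SameConnection conn conn' := by
  intro x Y hY
  obtain ⟨U, s, hU, hx, hs, hsP⟩ := P.exists_section x
  rw [hconn.isConnection.eq_frameConnection hconn.torsion_mem hρ hU hs hsP hx hY,
    hconn'.isConnection.eq_frameConnection hconn'.torsion_mem hρ hU hs hsP hx hY]

set_option synthInstance.maxHeartbeats 200000 in
/-- A connection on `P` with torsion in `D` is automatically smooth, its form `ρ c` in a local
section of `P` being a linear function of the structure function `c`. -/
theorem GStructure.IsConnection.contMDiff (hconn : P.IsConnection conn)
    (htor : ∀ (x : M), ∀ u ∈ P.frames x, torsionFunction conn u ∈ D)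
    {ρ : (V →L[ℝ] V →L[ℝ] V) →ₗ[ℝ] (V →L[ℝ] V →L[ℝ] V)}
    (hρ : ∀ φ ∈ homInto (linearLieAlgebra G), ∀ c, spencer V φ - c ∈ D → φ = ρ c) :
    CovariantDerivative.ContMDiffCovariantDerivative conn ∞ := by
  refine ⟨⟨fun {Y} hY => contMDiffOn_univ.2 fun x => ?_⟩⟩
  obtain ⟨U, s, hU, hx, hs, hsP⟩ := P.exists_section x
  have hY' : ∀ y, ContMDiffAt 𝓘(ℝ, V) 𝓘(ℝ, V).tangent ∞
      (fun y => (⟨y, Y y⟩ : TangentBundle 𝓘(ℝ, V) M)) y :=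
    fun y => ((contMDiffOn_univ.1 hY) y).of_le (by simp)
  have hφ : ContMDiffAt 𝓘(ℝ, V) 𝓘(ℝ, V →L[ℝ] V →L[ℝ] V) ∞
      (fun y => ρ (structureFunction s y)) x :=
    contMDiffAt_linearMap_comp (E := V →L[ℝ] V →L[ℝ] V) (W := V →L[ℝ] V →L[ℝ] V) ρ
      (hs.contMDiffAt_structureFunction hU hx)
  refine (hs.contMDiffAt_frameConnection hU hx hφ (hY' x)).congr_of_eventuallyEq ?_
  filter_upwards [hU.mem_nhds hx] with y hy
  rw [hconn.eq_frameConnection htor hρ hU hs hsP hy ((hY' y).mdifferentiableAt (by simp))]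

/-- Change of local section: if the transition function `g` from `s` to `s'` has values in the
commutant of `K`, then so has its differential, hence also the connection form
`g⁻¹ d g + g⁻¹ φ g` in the frame `s'`. -/
theorem IsSmoothLocalFrame.frameConnection_transition {K : Set (V →L[ℝ] V)}
    (hs : IsSmoothLocalFrame s U) (hU : IsOpen U) (hx : x ∈ U)
    (hs' : IsSmoothLocalFrame s' U') (hU' : IsOpen U') (hx' : x ∈ U')
    (hg : ∀ y ∈ U ∩ U', ∃ g : V ≃L[ℝ] V, (g : V →L[ℝ] V) ∈ commutant K ∧ s' y = g.trans (s y))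
    {φ : M → V →L[ℝ] V →L[ℝ] V} (hφ : φ x ∈ homInto (commutant K))
    (X : TangentSpace 𝓘(ℝ, V) x) :
    ∃ A ∈ commutant K, ∀ v, frameConnection s φ (fun y => s' y v) x X = s' x (A v) := by
  have hcov := hs.isCovariantDerivativeOn hU φ
  have hd := hs'.mdifferentiableAt_apply hU' hx'
  let A : V →ₗ[ℝ] V :=
    { toFun := fun v => (s' x).symm (frameConnection s φ (fun y => s' y v) x X)
      map_add' := fun v w => by
        rw [← map_add, ← add_apply, ← hcov.add (hd v) (hd w) hx]
        simp only [map_add]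
        rfl
      map_smul' := fun c v => by
        rw [RingHom.id_apply, ← map_smul, ← smul_apply, ← hcov.smul_const c (hd v) hx]
        simp only [map_smul]
        rfl }
  refine ⟨LinearMap.toContinuousLinearMap A, fun J hJ v => ?_,
    fun v => ((s' x).apply_symm_apply _).symm⟩
  -- The function `s⁻¹ (s' v)` is `g v`, and `g J v = J g v` near `x` can be differentiated.
  change (s' x).symm (frameConnection s φ (fun y => s' y (J v)) x X) =
    J ((s' x).symm (frameConnection s φ (fun y => s' y v) x X))
  have hcomm : ∀ y ∈ U ∩ U', (s y).symm (s' y (J v)) = J ((s y).symm (s' y v)) := by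
    intro y hy
    obtain ⟨g, hgK, hgy⟩ := hg y hy
    rw [hgy]
    simpa using hgK J hJ v
  have hev : (fun y => (s y).symm (s' y (J v))) =ᶠ[𝓝 x] fun y => J ((s y).symm (s' y v)) := by
    filter_upwards [(hU.inter hU').mem_nhds ⟨hx, hx'⟩] with y hy using hcomm y hy
  obtain ⟨g, hgK, hgx⟩ := hg x ⟨hx, hx'⟩
  have hsymm : ∀ z, (s' x).symm (s x z) = g.symm z := fun z => by
    rw [ContinuousLinearEquiv.symm_apply_eq, hgx]
    simp
  have hginv : ∀ z, g.symm (J z) = J (g.symm z) := fun z => by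
    have h := hgK J hJ (g.symm z)
    rw [ContinuousLinearEquiv.symm_apply_eq]
    simpa using h.symm
  rw [frameConnection_apply, frameConnection_apply, hsymm, hsymm, ← hginv, mvfderiv_congr hev,
    mvfderiv_clm_comp J (hs.mdifferentiableAt_symm_apply hU hx (hd v)), hcomm x ⟨hx, hx'⟩,
    hφ _ J hJ, map_add J]

/-- Existence: at every point a local section of `P` around this point is chosen, and the connection
with form `ρ c` in this section is taken, `c` being the structure function. The axioms of a
connection, its compatibility with `P` and its torsion concern one point at a time. Smoothness
follows from `GStructure.IsConnection.contMDiff`, although the chosen sections at neighbouring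
points are unrelated. -/
theorem GStructure.exists_isDConnection (P : GStructure G M) {K : Set (V →L[ℝ] V)}
    (hG : IsCommutantGroup G K) (hD : IsInvariantComplement G D)
    {ρ : (V →L[ℝ] V →L[ℝ] V) →ₗ[ℝ] (V →L[ℝ] V →L[ℝ] V)}
    (hρ : ∀ c ∈ torsionSpace V,
      ρ c ∈ homInto (linearLieAlgebra G) ∧ spencer V (ρ c) - c ∈ D)
    (hρ' : ∀ φ ∈ homInto (linearLieAlgebra G), ∀ c, spencer V φ - c ∈ D → φ = ρ c) :
    ∃ conn : CovariantDerivative 𝓘(ℝ, V) V (TangentSpace 𝓘(ℝ, V) : M → Type _),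
      P.IsDConnection D conn := by
  have : CompleteSpace V := FiniteDimensional.complete ℝ V
  have h𝔤 := linearLieAlgebra_eq_commutant hG
  choose U s hU hxU hs hsP using P.exists_section
  let φ : M → M → V →L[ℝ] V →L[ℝ] V := fun x y => ρ (structureFunction (s x) y)
  have hcov := fun x => (hs x).isCovariantDerivativeOn (hU x) (φ x)
  let conn : CovariantDerivative 𝓘(ℝ, V) V (TangentSpace 𝓘(ℝ, V) : M → Type _) :=
    { toFun := fun Y x => frameConnection (s x) (φ x) Y x
      isCovariantDerivativeOnUniv :=
        { add := fun {_ _ x} hY hY' _ => (hcov x).add hY hY' (hxU x)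
          leibniz := fun {_ _ x} hY hg _ => (hcov x).leibniz hY hg (hxU x) } }
  have hφ := fun x => hρ _ ((hs x).structureFunction_mem (hU x) (hxU x))
  have hconn : P.IsConnection conn := by
    intro U' s' hU' hs' hsP' x hx' X
    rw [h𝔤]
    refine (hs x).frameConnection_transition (hU x) (hxU x) hs' hU' hx' (fun y hy => ?_)
      (h𝔤 ▸ (hφ x).1) X
    obtain ⟨g, hg, hgy⟩ := (P.mem_iff y _ (hsP x y hy.1) _).1 (hsP' y hy.2)
    exact ⟨g, (hG g).1 hg, hgy⟩
  have htor : ∀ (x : M), ∀ u ∈ P.frames x, torsionFunction conn u ∈ D := by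
    intro x u hu
    obtain ⟨g, hg, rfl⟩ := (P.mem_iff x _ (hsP x x (hxU x)) u).1 hu
    rw [torsionFunction_trans]
    refine hD.invariant g.symm (G.inv_mem hg) _ ?_
    rw [(hs x).torsionFunction_eq (hU x) (hxU x) conn (φ := φ x x) fun v w => ?_]
    · exact (hφ x).2
    · refine (frameConnection_frame (φ x) w (s x x v)).trans ?_
      rw [ContinuousLinearEquiv.symm_apply_apply]
  exact ⟨conn, hconn.contMDiff htor hρ', hconn, htor⟩

end DConnections

/-! ### Almost Clifford structures -/

theorem mainTheorem3 (s t m : ℕ) (hst : 1 < s + t) (hm : 1 ≤ m)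
    (e : ClModel s t m ≃ₗ[ℝ] (Fin m → Cl s t))
    (M : Type*) [TopologicalSpace M] [T2Space M] [ChartedSpace (ClModel s t m) M]
    [IsManifold 𝓘(ℝ, ClModel s t m) ∞ M]
    (P : GStructure (cliffordGL e) M) :
    P.IsOfType 1 ∧
    ∀ D : Submodule ℝ (ClModel s t m →L[ℝ] ClModel s t m →L[ℝ] ClModel s t m),
      IsInvariantComplement (cliffordGL e) D →
      ∃ conn : CovariantDerivative 𝓘(ℝ, ClModel s t m) (ClModel s t m)
          (TangentSpace 𝓘(ℝ, ClModel s t m) : M → Type _),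
        P.IsDConnection D conn ∧
        ∀ conn' : CovariantDerivative 𝓘(ℝ, ClModel s t m) (ClModel s t m)
            (TangentSpace 𝓘(ℝ, ClModel s t m) : M → Type _),
          P.IsDConnection D conn' → SameConnection conn conn' := by
  refine ⟨linearGroupIsOfType_cliffordGL e hst hm, fun D hD => ?_⟩
  have hinj : Set.InjOn (spencer (ClModel s t m)) (homInto (linearLieAlgebra (cliffordGL e))) :=
    spencer_injOn fun B hB hsymm => by
      ext1 v
      ext1 w
      exact eq_zero_of_symm_of_mem_cliffordGL e hst (fun v => ⟨B v, hB v, fun _ => rfl⟩) hsymm v w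
  obtain ⟨ρ, hρ, hρ'⟩ := exists_spencer_correction hD hinj
  obtain ⟨conn, hconn⟩ := P.exists_isDConnection (isCommutantGroup_cliffordGL e) hD hρ hρ'
  exact ⟨conn, hconn, fun conn' hconn' => hconn.sameConnection hρ' hconn'⟩

end
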